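/- Fix an integer $d\ge 1$. For an integer $n\ge 1$ let $r_d(n)$ be the number of distinct $d$-th powers in a reduced system of residues modulo $n$, i.e. the cardinality of $\{m^d : m\in(\mathbb{Z}/n\mathbb{Z})^{\times}\}$ (so $r_d(1)=1$), and set $s_d(n)=r_d(n)/n$. Let $(q_k)_{k\ge 1}$ be a strictly increasing sequence of positive integers, let $(\alpha_k)_{k\ge 1}$ be a sequence of positive real numbers, and let $a\ge 1$ be an integer. Assume that (a) $\sum_{k=1}^{\infty}\alpha_k=+\infty$; (b) there is a real number $c>0$ such that $\sum_{k=1}^{n}\alpha_k\, s_d(q_k^d) > c\sum_{k=1}^{n}\alpha_k$ for infinitely many positive integers $n$; (c) $\gcd(q_k,a)=1$ for all $k\ge 1$. Then for Lebesgue-almost every $x\in\mathbb{R}$ there are infinitely many $k\ge 1$ for which there exists an integer $p_k$ relatively prime to $q_k$ such that $$\left|x-\frac{p_k}{q_k^d}\right|<\frac{\alpha_k}{q_k^d}\qquad\text{and}\qquad p_k\equiv a\,b_k^d \pmod{q_k}\ \text{ for some integer } b_k \text{ relatively prime to } q_k.$$ -/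

import Mathlib

/-- `r_d(n)`: the number of distinct `d`-th powers in a reduced system of residues modulo `n`,
i.e. the cardinality of `{m ^ d : m ∈ (ℤ/nℤ)ˣ}` (it is `1` for `n = 1`). -/
noncomputable def powerResidueCount (d n : ℕ) : ℕ :=
  (Set.range fun m : (ZMod n)ˣ => m ^ d).ncard

/-- `s_d(n) = r_d(n) / n`. -/
noncomputable def powerResidueDensity (d n : ℕ) : ℝ :=
  (powerResidueCount d n : ℝ) / (n : ℝ)

/-!
Call an integer `p` *admissible* for `q` if it is coprime to `q` and congruent modulo `q` to `a`
times the `d`-th power of a unit. Admissibility only depends on `p` modulo `q`, and the proportion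
of admissible residues is `powerResidueDensity d q`, which is at least
`powerResidueDensity d (q ^ d)` (`powerResidueDensity_pow_le`).

The density hypothesis forces `∑ α k` to diverge already over the indices at which the density is at
least `s = c / 2` (`not_summable_indicator_of_average_lt`). On these, `α k` may be replaced by
`b k = min (α k) ε` without losing divergence; at all other indices `b k = 0`. Let `E k` be the set
of reals within `b k / q k ^ d` of a fraction `p / q k ^ d` with `p` admissible. Two facts are used.

* Equidistribution: `vol (E k ∩ A) ≥ s * b k * vol A` for every finite union `A` of intervals and
  all large `k` (`eventually_le_ncard_admissibleNumerators`, `le_volume_approxSet_inter`). For `d ≥ 2` this is trivial, because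
  `q` is small compared with `q ^ d`; for `d = 1` it is Legendre's sieve with the bound `2 √q` for
  the number of divisors.
* Overlaps: `vol (E k ∩ E l ∩ (-R, R)) ≤ 16 (R + 1) * b k * b l` for `k ≠ l`
  (`volume_approxSet_inter_le`), as in the work of Duffin and Schaeffer. Reducedness of the
  fractions enters here, by excluding exact coincidences.

If the conclusion fails, a compact set `Z` of positive measure misses all `E k` with `k ≥ K₀`. Take
a finite union `A ⊇ Z` of intervals, with `vol (A \ Z)` tiny. Bonferroni's inequality for a block
of indices whose `b k` add up to about `ε` shows that the `E k` cover a part of `A` whose measure is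
bounded below in terms of `s`, `vol Z` and `R` alone, although they meet `A` only in `A \ Z`. The overlap
estimate need not be localized to `A`, and no zero-one law is needed, since the lower bound does not
depend on the choice of `A`.
-/

/-! ### Counting integers in intervals -/

theorem Nat.card_divisors_le_two_mul_sqrt (n : ℕ) : n.divisors.card ≤ 2 * n.sqrt := by
  classical
  -- Of two complementary divisors one is at most `√n`.
  have hsub : n.divisors ⊆ Finset.Icc 1 n.sqrt ∪ (Finset.Icc 1 n.sqrt).image (n / ·) := by
    intro e he
    obtain ⟨⟨f, hf⟩, hn⟩ := Nat.mem_divisors.1 he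
    have he0 : 0 < e := Nat.pos_of_mem_divisors he
    have hf0 : 0 < f := Nat.pos_of_ne_zero (by rintro rfl; simp [hf] at hn)
    rw [Finset.mem_union, Finset.mem_image]
    rcases le_total e f with h | h
    · refine Or.inl (Finset.mem_Icc.2 ⟨he0, Nat.le_sqrt.2 ?_⟩)
      rw [hf]; exact Nat.mul_le_mul_left e h
    · refine Or.inr ⟨f, Finset.mem_Icc.2 ⟨hf0, Nat.le_sqrt.2 ?_⟩, ?_⟩
      · rw [hf]; exact Nat.mul_le_mul_right f h
      · rw [hf]; exact Nat.mul_div_cancel _ hf0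
  refine (Finset.card_le_card hsub).trans ((Finset.card_union_le _ _).trans ?_)
  have := Finset.card_image_le (s := Finset.Icc 1 n.sqrt) (f := (n / ·))
  simp only [Nat.card_Icc, Nat.add_sub_cancel] at this ⊢
  omega

theorem sub_div_sub_one_le_card_modEq {A B r : ℤ} (hr : 0 < r) (v : ℤ) :
    ((B : ℝ) - A) / r - 1 ≤ ((Finset.Ioc A B).filter (· ≡ v [ZMOD r])).card := by
  have h := Int.Ioc_filter_modEq_card A B hr v
  have h1 : (⌊((B : ℚ) - v) / r⌋ - ⌊((A : ℚ) - v) / r⌋ : ℤ) ≤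
      (((Finset.Ioc A B).filter (· ≡ v [ZMOD r])).card : ℤ) := h ▸ le_max_left _ _
  have h2 : ((⌊((B : ℚ) - v) / r⌋ : ℚ) - ⌊((A : ℚ) - v) / r⌋) ≤
      (((Finset.Ioc A B).filter (· ≡ v [ZMOD r])).card : ℚ) := by exact_mod_cast h1
  have h3 := Int.lt_floor_add_one (((B : ℚ) - v) / r)
  have h4 := Int.floor_le (((A : ℚ) - v) / r)
  have h5 : ((B : ℚ) - v) / r - ((A : ℚ) - v) / r = ((B : ℚ) - A) / r := by ring
  have h6 : ((B : ℚ) - A) / r - 1 ≤ ((Finset.Ioc A B).filter (· ≡ v [ZMOD r])).card := by linarith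
  exact_mod_cast h6

theorem abs_card_dvd_sub_le {A B r : ℤ} (hAB : A ≤ B) (hr : 0 < r) :
    |(((Finset.Ioc A B).filter (r ∣ ·)).card : ℝ) - ((B : ℝ) - A) / r| ≤ 1 := by
  have h := Int.Ioc_filter_dvd_card A B hr
  have hr' : (0 : ℚ) < r := by exact_mod_cast hr
  rw [max_eq_left (sub_nonneg.2 (Int.floor_le_floor (by gcongr)))] at h
  have h2 : (((Finset.Ioc A B).filter (r ∣ ·)).card : ℚ) = ⌊(B : ℚ) / r⌋ - ⌊(A : ℚ) / r⌋ := by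
    exact_mod_cast h
  have h6 : |(((Finset.Ioc A B).filter (r ∣ ·)).card : ℚ) - ((B : ℚ) - A) / r| ≤ 1 := by
    rw [h2, abs_le, sub_div]
    have h3 := Int.lt_floor_add_one ((B : ℚ) / r)
    have h4 := Int.floor_le ((A : ℚ) / r)
    have h5 := Int.lt_floor_add_one ((A : ℚ) / r)
    have h7 := Int.floor_le ((B : ℚ) / r)
    constructor <;> linarith
  exact_mod_cast h6

open ArithmeticFunction in
theorem card_coprime_Ioc_eq_sum_moebius {q : ℕ} (hq : 0 < q) (A B : ℤ) :
    (((Finset.Ioc A B).filter (IsCoprime · (q : ℤ))).card : ℝ) =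
      ∑ e ∈ q.divisors, (moebius e : ℝ) * ((Finset.Ioc A B).filter ((e : ℤ) ∣ ·)).card := by
  classical
  have key : ∀ p : ℤ, (if IsCoprime p (q : ℤ) then (1 : ℤ) else 0) =
      ∑ e ∈ q.divisors, if (e : ℤ) ∣ p then moebius e else 0 := by
    intro p
    have hg : Int.gcd p q ≠ 0 := by
      rw [Ne, Int.gcd_eq_zero_iff]; omega
    have hdiv : q.divisors.filter (fun e : ℕ => (e : ℤ) ∣ p) = (Int.gcd p q).divisors := by
      ext e
      simp only [Finset.mem_filter, Nat.mem_divisors, Int.gcd, Nat.dvd_gcd_iff,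
        Int.natCast_dvd, Int.natAbs_natCast]
      have := hq.ne'
      simp only [Int.gcd, Int.natAbs_natCast] at hg
      tauto
    rw [← Finset.sum_filter, hdiv, ← coe_mul_zeta_apply, moebius_mul_coe_zeta, one_apply]
    simp only [Int.isCoprime_iff_gcd_eq_one]
  have h : (((Finset.Ioc A B).filter (IsCoprime · (q : ℤ))).card : ℤ) =
      ∑ e ∈ q.divisors, moebius e * ((Finset.Ioc A B).filter ((e : ℤ) ∣ ·)).card := by
    rw [Finset.card_filter, Nat.cast_sum]
    simp only [Nat.cast_ite, Nat.cast_one, Nat.cast_zero, key]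
    rw [Finset.sum_comm]
    refine Finset.sum_congr rfl fun e _ => ?_
    rw [Finset.card_filter, Nat.cast_sum, Finset.mul_sum]
    refine Finset.sum_congr rfl fun p _ => ?_
    split_ifs <;> simp
  exact_mod_cast h

/-- Legendre's sieve in short form: the integers coprime to `q` are equidistributed in intervals
up to an error governed by the number of divisors of `q`. -/
theorem abs_card_coprime_Ioc_sub_le {q : ℕ} (hq : 0 < q) {A B : ℤ} (hAB : A ≤ B) :
    |(((Finset.Ioc A B).filter (IsCoprime · (q : ℤ))).card : ℝ) -
      ((B : ℝ) - A) * ∑ e ∈ q.divisors, (ArithmeticFunction.moebius e : ℝ) / e| ≤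
      q.divisors.card := by
  rw [card_coprime_Ioc_eq_sum_moebius hq, Finset.mul_sum, ← Finset.sum_sub_distrib]
  refine (Finset.abs_sum_le_sum_abs _ _).trans ?_
  rw [Finset.card_eq_sum_ones, Nat.cast_sum]
  refine Finset.sum_le_sum fun e he => ?_
  have he0 : (0 : ℤ) < e := by exact_mod_cast Nat.pos_of_mem_divisors he
  have h1 := abs_card_dvd_sub_le hAB he0
  have h2 : |(ArithmeticFunction.moebius e : ℝ)| ≤ 1 := by
    exact_mod_cast (ArithmeticFunction.abs_moebius_le_one (n := e))
  have h3 : ∀ m N L f : ℝ, m * N - L * (m / f) = m * (N - L / f) := fun m N L f => by ring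
  rw [h3, abs_mul]
  push_cast at h1
  calc _ ≤ 1 * 1 := mul_le_mul h2 h1 (abs_nonneg _) zero_le_one
    _ = _ := by simp

/-! ### Power residues modulo `q` and modulo `q ^ d` -/

theorem powerResidueCount_le (d : ℕ) {n : ℕ} (hn : 0 < n) : powerResidueCount d n ≤ n := by
  have : NeZero n := ⟨hn.ne'⟩
  refine (Set.ncard_le_ncard (Set.subset_univ _)).trans ?_
  rw [Set.ncard_univ, Nat.card_eq_fintype_card, ZMod.card_units_eq_totient]
  exact Nat.totient_le n

/-- Passing from a modulus `m * t` to the divisor `m` loses at most a factor `t` of power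
residues, since each class modulo `m` has `t` lifts. -/
theorem powerResidueCount_mul_le (d : ℕ) {m t : ℕ} (hm : 0 < m) (ht : 0 < t) :
    powerResidueCount d (m * t) ≤ t * powerResidueCount d m := by
  classical
  have : NeZero m := ⟨hm.ne'⟩
  have : NeZero t := ⟨ht.ne'⟩
  unfold powerResidueCount
  have e1 : ∀ n : ℕ, ∀ [NeZero n], (Set.range fun m : (ZMod n)ˣ => m ^ d).ncard =
      (Finset.univ.image fun m : (ZMod n)ˣ => m ^ d).card := fun n _ => by
    rw [← Set.ncard_coe_finset]; simp
  rw [e1, e1]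
  refine Finset.card_le_mul_card_image_of_maps_to (f := ZMod.unitsMap (Dvd.intro t rfl)) ?_ _ ?_
  · intro x hx
    obtain ⟨y, -, rfl⟩ := Finset.mem_image.1 hx
    exact Finset.mem_image.2 ⟨ZMod.unitsMap (Dvd.intro t rfl) y, Finset.mem_univ _, by simp⟩
  · intro y _
    have : ((Finset.range (m * t)).filter (· ≡ (y : ZMod m).val [MOD m])).card = t := by
      rw [← Nat.count_eq_card_filter_range, Nat.count_modEq_card _ hm]
      simp [hm]
    refine le_of_le_of_eq ?_ this
    refine Finset.card_le_card_of_injOn (fun x => (x : ZMod (m * t)).val) ?_ ?_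
    · intro x hx
      obtain ⟨-, hx⟩ := Finset.mem_filter.1 hx
      simp only [Finset.coe_filter, Finset.mem_range, Set.mem_ofPred_eq]
      refine ⟨ZMod.val_lt _, ?_⟩
      rw [← ZMod.natCast_eq_natCast_iff, ZMod.natCast_zmod_val, ← hx, ZMod.unitsMap_val,
        ZMod.natCast_val]
    · intro x _ y _ h
      exact Units.ext (ZMod.val_injective _ h)

theorem powerResidueDensity_le_one (d : ℕ) {n : ℕ} (hn : 0 < n) :
    powerResidueDensity d n ≤ 1 :=
  div_le_one_of_le₀ (by exact_mod_cast powerResidueCount_le d hn) (Nat.cast_nonneg n)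

theorem powerResidueDensity_pow_le {d q : ℕ} (hd : 1 ≤ d) (hq : 0 < q) :
    powerResidueDensity d (q ^ d) ≤ powerResidueDensity d q := by
  obtain ⟨d, rfl⟩ := Nat.exists_eq_add_of_le' hd
  have h := powerResidueCount_mul_le (d + 1) hq (pow_pos hq d)
  unfold powerResidueDensity
  have hq' : (0 : ℝ) < q := by exact_mod_cast hq
  rw [pow_succ', div_le_div_iff₀ (by push_cast; positivity) hq']
  have h' : (powerResidueCount (d + 1) (q * q ^ d) : ℝ) ≤
      q ^ d * powerResidueCount (d + 1) q := by exact_mod_cast h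
  push_cast
  nlinarith

/-! ### Equidistribution of admissible numerators -/

/-- The admissible numerators for the denominator `q ^ d`: the integers coprime to `q` that are
congruent modulo `q` to `a` times the `d`-th power of an integer coprime to `q`. -/
def admissibleNumerators (a : ℤ) (d q : ℕ) : Set ℤ :=
  {p | IsCoprime p (q : ℤ) ∧ ∃ b : ℤ, IsCoprime b (q : ℤ) ∧ p ≡ a * b ^ d [ZMOD (q : ℤ)]}

/-- The admissible numerators fill whole residue classes modulo `q`, and there are
`powerResidueCount d q` such classes. -/
theorem le_ncard_admissibleNumerators {a : ℤ} (d : ℕ) {q : ℕ} (hq : 0 < q)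
    (ha : IsCoprime (q : ℤ) a) (A B : ℤ) :
    (powerResidueCount d q : ℝ) * (((B : ℝ) - A) / q - 1) ≤
      (admissibleNumerators a d q ∩ Set.Ioc A B).ncard := by
  classical
  have : NeZero q := ⟨hq.ne'⟩
  have hau : IsUnit (a : ZMod q) := (ZMod.coe_int_isUnit_iff_isCoprime a q).2 ha
  obtain ⟨u, hu⟩ := hau
  set T : Finset (ZMod q) :=
    Finset.univ.image fun m : (ZMod q)ˣ => ((u * m ^ d : (ZMod q)ˣ) : ZMod q)
    with hT
  have hcard : powerResidueCount d q = T.card := by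
    have : T = ((Finset.univ.image fun m : (ZMod q)ˣ => m ^ d)).image
        (fun m => ((u * m : (ZMod q)ˣ) : ZMod q)) := by
      rw [hT, Finset.image_image]; rfl
    rw [this, Finset.card_image_of_injective _
      (fun x y h => mul_left_cancel (Units.ext h)), powerResidueCount, ← Set.ncard_coe_finset]
    simp
  set S : Finset ℤ := (Finset.Ioc A B).filter (fun p : ℤ => (p : ZMod q) ∈ T) with hS
  have hsub : (S : Set ℤ) ⊆ admissibleNumerators a d q ∩ Set.Ioc A B := by
    intro p hp
    obtain ⟨hp1, hp2⟩ := Finset.mem_filter.1 (Finset.mem_coe.1 hp)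
    obtain ⟨m, -, hm⟩ := Finset.mem_image.1 hp2
    refine ⟨⟨?_, ((m : ZMod q).val : ℤ), ?_, ?_⟩, Finset.mem_Ioc.1 hp1⟩
    · rw [isCoprime_comm]
      exact (ZMod.coe_int_isUnit_iff_isCoprime p q).1 (hm ▸ Units.isUnit _)
    · rw [isCoprime_comm]
      exact (ZMod.coe_int_isUnit_iff_isCoprime _ q).1 (by simp)
    · rw [← ZMod.intCast_eq_intCast_iff, ← hm]
      simp [hu]
  refine le_trans ?_ (Nat.cast_le.2 (Set.ncard_le_ncard hsub ((Set.finite_Ioc A B).inter_of_right _)))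
  have hfib : Set.MapsTo (fun p : ℤ => (p : ZMod q)) S T :=
    fun p hp => (Finset.mem_filter.1 (Finset.mem_coe.1 hp)).2
  rw [Set.ncard_coe_finset, Finset.card_eq_sum_card_fiberwise hfib, hcard, ← nsmul_eq_mul,
    Nat.cast_sum]
  refine Finset.card_nsmul_le_sum _ _ _ fun y hy => ?_
  refine (sub_div_sub_one_le_card_modEq (A := A) (B := B) (r := q) (by exact_mod_cast hq)
    (y.val : ℤ)).trans (Nat.cast_le.2 (Finset.card_le_card ?_))
  intro p hp
  obtain ⟨hp1, hp2⟩ := Finset.mem_filter.1 hp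
  have : (p : ZMod q) = y := by
    rw [(ZMod.intCast_eq_intCast_iff _ _ _).2 hp2]; simp
  simp [hS, this, hy, Finset.mem_Ioc.1 hp1]

theorem powerResidueCount_one_eq_totient {q : ℕ} (hq : 0 < q) :
    powerResidueCount 1 q = q.totient := by
  have : NeZero q := ⟨hq.ne'⟩
  simp [powerResidueCount, ZMod.card_units_eq_totient, Nat.card_eq_fintype_card, Set.ncard_univ,
    Set.range_id']

theorem sum_moebius_div_eq_totient_div {q : ℕ} (hq : 0 < q) :
    ∑ e ∈ q.divisors, (ArithmeticFunction.moebius e : ℝ) / e = (q.totient : ℝ) / q := by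
  have h := (ArithmeticFunction.sum_eq_iff_sum_mul_moebius_eq (R := ℝ)
    (f := fun n => (n.totient : ℝ)) (g := fun n => (n : ℝ))).1
    (fun n _ => by exact_mod_cast Nat.sum_totient n) q hq
  rw [Nat.sum_divisorsAntidiagonal (fun x y => (ArithmeticFunction.moebius x : ℝ) * (y : ℝ))] at h
  have hq' : (q : ℝ) ≠ 0 := by exact_mod_cast hq.ne'
  rw [eq_div_iff hq', ← h, Finset.sum_mul]
  refine Finset.sum_congr rfl fun e he => ?_
  have he0 : (e : ℝ) ≠ 0 := by exact_mod_cast (Nat.pos_of_mem_divisors he).ne'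
  rw [Nat.cast_div (Nat.dvd_of_mem_divisors he) he0]
  ring

/-- For `d = 1` the count in `le_ncard_admissibleNumerators` is useless for intervals of length
comparable with `q`; the sieve gives a good error term. -/
theorem le_ncard_admissibleNumerators_one {a : ℤ} {q : ℕ} (hq : 0 < q)
    (ha : IsCoprime (q : ℤ) a) {A B : ℤ} (hAB : A ≤ B) :
    powerResidueDensity 1 q * ((B : ℝ) - A) - 2 * √(q : ℝ) ≤
      (admissibleNumerators a 1 q ∩ Set.Ioc A B).ncard := by
  classical
  have hadm : admissibleNumerators a 1 q ∩ Set.Ioc A B =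
      ((Finset.Ioc A B).filter (IsCoprime · (q : ℤ)) : Set ℤ) := by
    ext p
    simp only [admissibleNumerators, Set.mem_inter_iff, Set.mem_ofPred_eq, Set.mem_Ioc,
      Finset.coe_filter, Finset.mem_Ioc]
    refine ⟨fun h => ⟨h.2, h.1.1⟩, fun h => ⟨⟨h.2, ?_⟩, h.1⟩⟩
    obtain ⟨x, y, hxy⟩ := ha
    refine ⟨y * p, IsCoprime.mul_left ⟨a, x, by linarith⟩ h.2, ?_⟩
    rw [Int.modEq_iff_dvd]
    exact ⟨-(x * p), by linear_combination p * hxy⟩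
  have h1 := (abs_le.1 (abs_card_coprime_Ioc_sub_le hq hAB)).1
  rw [sum_moebius_div_eq_totient_div hq] at h1
  have h2 : (q.divisors.card : ℝ) ≤ 2 * √(q : ℝ) := by
    have h3 : (q.divisors.card : ℝ) ≤ 2 * (q.sqrt : ℝ) := by
      exact_mod_cast Nat.card_divisors_le_two_mul_sqrt q
    have h4 := Real.nat_sqrt_le_real_sqrt (a := q)
    linarith
  rw [hadm, Set.ncard_coe_finset, powerResidueDensity, powerResidueCount_one_eq_totient hq]
  linarith [mul_comm ((B : ℝ) - A) ((q.totient : ℝ) / q)]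

open Filter in
/-- Equidistribution of the admissible numerators: in the part of a fixed interval `[u, v)` that
keeps a distance `1 / q ^ d` from its ends there is the expected proportion of admissible
fractions, up to a factor `2`. -/
theorem eventually_le_ncard_admissibleNumerators {a : ℤ} {d : ℕ} (hd : 1 ≤ d) {s u v : ℝ}
    (hs : 0 < s) (huv : u < v) :
    ∀ᶠ q : ℕ in atTop, IsCoprime (q : ℤ) a → s ≤ powerResidueDensity d q →
      s / 2 * (v - u) * (q : ℝ) ^ d ≤
        (admissibleNumerators a d q ∩ Set.Ioc ⌈u * (q : ℝ) ^ d⌉ (⌊v * (q : ℝ) ^ d⌋ - 1)).ncard := by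
  have hlen : 0 < v - u := sub_pos.2 huv
  have hlarge : ∀ M : ℝ, ∀ᶠ q : ℕ in atTop, M ≤ √(q : ℝ) := fun M =>
    (Real.tendsto_sqrt_atTop.comp tendsto_natCast_atTop_atTop).eventually_ge_atTop M
  filter_upwards [eventually_gt_atTop 0, hlarge 1, hlarge (8 / (v - u)),
    hlarge (16 / (s * (v - u)))] with q hq h1 h8 h8s ha hsq
  rw [div_le_iff₀ hlen] at h8
  rw [div_le_iff₀ (mul_pos hs hlen)] at h8s
  set r := √(q : ℝ) with hr
  have hrr : r * r = q := Real.mul_self_sqrt (Nat.cast_nonneg q)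
  have hq0 : (0 : ℝ) < q := by exact_mod_cast hq
  have hqpow : (q : ℝ) ≤ (q : ℝ) ^ d := le_self_pow₀ (by nlinarith) (by omega)
  set Q : ℝ := (q : ℝ) ^ d with hQ
  -- With `A`, `B` the ends of the interval of numerators, `B - A` is only slightly less than
  -- `(v - u) * Q`, so that half the expected number leaves room for the error terms.
  have hA := Int.ceil_lt_add_one (u * Q)
  have hB := Int.lt_floor_add_one (v * Q)
  set A : ℤ := ⌈u * Q⌉
  set B : ℤ := ⌊v * Q⌋ - 1 with hBdef
  have hB' : v * Q - 2 < (B : ℝ) := by rw [hBdef]; push_cast; linarith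
  have hBA : (v - u) * Q - 3 ≤ (B : ℝ) - A := by linarith
  have hq8 : 8 ≤ (v - u) * q := by nlinarith
  have hBA0 : (v - u) * Q * (5 / 8) ≤ (B : ℝ) - A := by nlinarith
  have hQ0 : 0 < Q := hq0.trans_le hqpow
  have hAB : A ≤ B := by
    have : (0 : ℝ) ≤ (B : ℝ) - A := le_trans (by positivity) hBA0
    exact_mod_cast sub_nonneg.1 this
  rcases hd.eq_or_lt with rfl | hd2
  · rw [pow_one] at hQ
    have h := le_ncard_admissibleNumerators_one hq ha hAB
    have h2 : s * ((v - u) * Q * (5 / 8)) ≤ powerResidueDensity 1 q * ((B : ℝ) - A) :=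
      mul_le_mul hsq hBA0 (by positivity) (hs.le.trans hsq)
    have h3 : 16 * r ≤ s * (v - u) * Q := by
      rw [hQ, ← hrr, mul_comm _ (r * r), mul_assoc, mul_comm 16]
      exact mul_le_mul_of_nonneg_left (by linarith) (by linarith)
    linarith
  · have h := le_ncard_admissibleNumerators d hq ha A B
    have hsq2 : (q : ℝ) * q ≤ Q := by
      rw [← sq]
      exact pow_le_pow_right₀ (by nlinarith) hd2
    have hqQ : (q : ℝ) ≤ (v - u) * Q / 8 := by nlinarith
    have h2 : s * ((v - u) * Q * (1 / 2)) ≤ powerResidueDensity d q * ((B : ℝ) - A - q) :=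
      mul_le_mul hsq (by linarith) (by positivity) (hs.le.trans hsq)
    have h3 : powerResidueDensity d q * ((B : ℝ) - A - q) =
        (powerResidueCount d q : ℝ) * (((B : ℝ) - A) / q - 1) := by
      rw [powerResidueDensity]; field_simp
    linarith

/-! ### Measure of the approximation sets -/

/-- Counting near coincidences `p / Q ≈ p' / Q'`: for a given value `m ≠ 0` of `p Q' - p' Q` the
numerator `p` is determined modulo `Q / gcd(Q, Q')`, while `m` runs through multiples of
`gcd(Q, Q')`, so that the gcd cancels. -/
theorem card_near_coincidences_le {Q Q' : ℕ} (hQ : 0 < Q) (hQ' : 0 < Q') (R : ℕ) {Δ : ℝ}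
    (hΔ : 0 ≤ Δ) (P : Finset (ℤ × ℤ))
    (hP : ∀ x ∈ P, x.1 ∈ Finset.Ioc (-(R * Q : ℤ)) (R * Q) ∧ x.1 * Q' ≠ x.2 * Q ∧
      |(x.1 : ℝ) * Q' - x.2 * Q| < Δ) :
    (P.card : ℝ) ≤ 4 * R * Δ := by
  classical
  obtain ⟨g, v, u, hg, hcop, rfl, rfl⟩ := Nat.exists_coprime' (Nat.gcd_pos_of_pos_left Q' hQ)
  have hv : 0 < v := Nat.pos_of_mul_pos_right hQ
  have hu : 0 < u := Nat.pos_of_mul_pos_right hQ'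
  have hgR : (0 : ℝ) < g := by exact_mod_cast hg
  set T : ℤ := ⌊Δ / g⌋ with hT
  have hT0 : 0 ≤ T := Int.floor_nonneg.2 (by positivity)
  have hmaps : ∀ x ∈ P, x.1 * u - x.2 * v ∈ (Finset.Icc (-T) T).erase 0 := by
    intro x hx
    obtain ⟨-, hne, hlt⟩ := hP x hx
    rw [Finset.mem_erase, Finset.mem_Icc, ← abs_le]
    constructor
    · intro h
      apply hne
      push_cast
      linear_combination (g : ℤ) * h
    · rw [hT, Int.le_floor, le_div_iff₀ hgR]
      refine le_of_eq_of_le ?_ hlt.le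
      push_cast
      have habs : ∀ z : ℝ, |z| * g = |z * g| := fun z => by rw [abs_mul, abs_of_pos hgR]
      rw [habs]
      congr 1
      ring
  have hfib : ∀ m ∈ (Finset.Icc (-T) T).erase 0,
      (P.filter (fun x => x.1 * u - x.2 * v = m)).card ≤ 2 * R * g := by
    intro m _
    rcases (P.filter (fun x => x.1 * u - x.2 * v = m)).eq_empty_or_nonempty with h0 | ⟨y, hy⟩
    · simp [h0]
    obtain ⟨-, hym⟩ := Finset.mem_filter.1 hy
    have hv' : (0 : ℤ) < v := by exact_mod_cast hv
    have hcard : ((Finset.Ioc (-(R * (v * g : ℕ) : ℤ)) (R * (v * g : ℕ))).filter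
        (· ≡ y.1 [ZMOD v])).card = 2 * R * g := by
      have h := Int.Ioc_filter_modEq_card (-(R * (v * g : ℕ) : ℤ)) (R * (v * g : ℕ)) hv' y.1
      have hvq : (v : ℚ) ≠ 0 := by exact_mod_cast hv.ne'
      have e1 : (((R * (v * g : ℕ) : ℤ) : ℚ) - (y.1 : ℚ)) / ((v : ℤ) : ℚ) =
          (((-(R * (v * g : ℕ) : ℤ) : ℤ) : ℚ) - y.1) / ((v : ℤ) : ℚ) +
            ((2 * R * g : ℤ) : ℚ) := by
        push_cast; field_simp; ring
      rw [e1, Int.floor_add_intCast, add_sub_cancel_left, max_eq_left (by positivity)] at h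
      exact_mod_cast h
    rw [← hcard]
    refine Finset.card_le_card_of_injOn Prod.fst ?_ ?_
    · intro x hx
      obtain ⟨hxP, hxm⟩ := Finset.mem_filter.1 (Finset.mem_coe.1 hx)
      refine Finset.mem_coe.2 (Finset.mem_filter.2 ⟨(hP x hxP).1, ?_⟩)
      have hdvd : (v : ℤ) ∣ (y.1 - x.1) * u := ⟨y.2 - x.2, by linear_combination hym - hxm⟩
      exact Int.modEq_iff_dvd.2
        ((Nat.isCoprime_iff_coprime.2 hcop).dvd_of_dvd_mul_right hdvd)
    · intro x hx z hz hxz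
      obtain ⟨-, hxm⟩ := Finset.mem_filter.1 (Finset.mem_coe.1 hx)
      obtain ⟨-, hzm⟩ := Finset.mem_filter.1 (Finset.mem_coe.1 hz)
      refine Prod.ext hxz (mul_right_cancel₀ hv'.ne' ?_)
      linear_combination (u : ℤ) * hxz - hxm + hzm
  have hcardT : (((Finset.Icc (-T) T).erase 0).card : ℝ) = 2 * T := by
    rw [Finset.card_erase_of_mem (by simp [hT0]), Int.card_Icc]
    have : (((T + 1 - -T).toNat - 1 : ℕ) : ℤ) = 2 * T := by omega
    exact_mod_cast this
  have hmain : (P.card : ℝ) ≤ (2 * R * g : ℕ) * (((Finset.Icc (-T) T).erase 0).card : ℝ) := by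
    exact_mod_cast Finset.card_le_mul_card_image_of_maps_to hmaps _ hfib
  rw [hcardT] at hmain
  have hTle : (T : ℝ) * g ≤ Δ := (le_div_iff₀ hgR).1 (Int.floor_le _)
  calc (P.card : ℝ) ≤ (2 * R * g : ℕ) * (2 * T) := hmain
    _ = 4 * R * (T * g) := by push_cast; ring
    _ ≤ 4 * R * Δ := by gcongr

/-- The reals closer than `β / Q` to a fraction `p / Q` with numerator in `V`. -/
def approxSet (V : Set ℤ) (Q β : ℝ) : Set ℝ :=
  {x | ∃ p ∈ V, |x - p / Q| < β / Q}

theorem abs_sub_div_lt_div_iff {x p Q β : ℝ} (hQ : 0 < Q) :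
    |x - p / Q| < β / Q ↔ |x * Q - p| < β := by
  rw [lt_div_iff₀ hQ]
  nth_rewrite 2 [← abs_of_pos hQ]
  rw [← abs_mul, sub_mul, div_mul_cancel₀ _ hQ.ne']

theorem mem_Ioc_of_abs_sub_div_lt {Q : ℕ} (hQ : 0 < Q) {x β : ℝ} {p : ℤ} {R : ℕ} (hβ : β ≤ 1)
    (hx : x ∈ Metric.ball (0 : ℝ) R) (hxp : |x - p / Q| < β / Q) :
    p ∈ Finset.Ioc (-((R + 1 : ℕ) * Q : ℤ)) ((R + 1 : ℕ) * Q) := by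
  have hQR : (1 : ℝ) ≤ Q := by exact_mod_cast hQ
  rw [Metric.mem_ball, Real.dist_eq, sub_zero, abs_lt] at hx
  rw [abs_sub_div_lt_div_iff (by linarith), abs_lt] at hxp
  have h1 : -(((R + 1 : ℕ) : ℝ) * Q) < p := by push_cast; nlinarith
  have h2 : (p : ℝ) < ((R + 1 : ℕ) : ℝ) * Q := by push_cast; nlinarith
  rw [Finset.mem_Ioc]
  exact ⟨by exact_mod_cast h1, by exact_mod_cast h2.le⟩

theorem isOpen_approxSet (V : Set ℤ) (Q β : ℝ) : IsOpen (approxSet V Q β) := by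
  have : approxSet V Q β = ⋃ p ∈ V, Metric.ball ((p : ℝ) / Q) (β / Q) := by
    ext x; simp [approxSet, Real.dist_eq]
  rw [this]
  exact isOpen_biUnion fun _ _ => Metric.isOpen_ball

theorem approxSet_mono {V : Set ℤ} {Q β γ : ℝ} (hQ : 0 ≤ Q) (h : β ≤ γ) :
    approxSet V Q β ⊆ approxSet V Q γ :=
  fun _ ⟨p, hp, hx⟩ => ⟨p, hp, hx.trans_le (by gcongr)⟩

open MeasureTheory in
/-- The overlap estimate: approximation sets for two denominators without common fractions
behave, in measure and up to a constant, at worst like independent events. -/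
theorem volume_approxSet_inter_le {Q Q' : ℕ} (hQ : 0 < Q) (hQ' : 0 < Q') {V V' : Set ℤ}
    (hVV' : ∀ p ∈ V, ∀ p' ∈ V', p * Q' ≠ p' * Q) {β γ : ℝ} (hβ : 0 ≤ β) (hγ : 0 ≤ γ) (hβ1 : β ≤ 1)
    (hγ1 : γ ≤ 1) (R : ℕ) :
    volume.real (approxSet V Q β ∩ approxSet V' Q' γ ∩ Metric.ball 0 R) ≤
      16 * (R + 1) * β * γ := by
  classical
  have hQR : (0 : ℝ) < Q := by exact_mod_cast hQ
  have hQR' : (0 : ℝ) < Q' := by exact_mod_cast hQ'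
  set Δ : ℝ := β * Q' + γ * Q with hΔ
  set P : Finset (ℤ × ℤ) :=
    ((Finset.Ioc (-((R + 1 : ℕ) * Q : ℤ)) ((R + 1 : ℕ) * Q)) ×ˢ
      (Finset.Ioc (-((R + 1 : ℕ) * Q' : ℤ)) ((R + 1 : ℕ) * Q'))).filter
    (fun x => x.1 * Q' ≠ x.2 * Q ∧ |(x.1 : ℝ) * Q' - x.2 * Q| < Δ) with hP
  have hcard : (P.card : ℝ) ≤ 4 * (R + 1 : ℕ) * Δ :=
    card_near_coincidences_le hQ hQ' (R + 1) (by positivity) P fun x hx =>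
      ⟨(Finset.mem_product.1 (Finset.mem_filter.1 hx).1).1, (Finset.mem_filter.1 hx).2⟩
  set ρ : ℝ := min (β / Q) (γ / Q') with hρ
  have hρ0 : 0 ≤ ρ := by positivity
  have hsub : approxSet V Q β ∩ approxSet V' Q' γ ∩ Metric.ball 0 R ⊆
      ⋃ x ∈ P, (Metric.ball ((x.1 : ℝ) / Q) (β / Q) ∩
        Metric.ball ((x.2 : ℝ) / Q') (γ / Q')) := by
    rintro y ⟨⟨⟨p, hp, hyp⟩, ⟨p', hp', hyp'⟩⟩, hyR⟩
    refine Set.mem_biUnion (x := (p, p')) (Finset.mem_coe.2 (Finset.mem_filter.2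
      ⟨Finset.mem_product.2 ⟨mem_Ioc_of_abs_sub_div_lt hQ hβ1 hyR hyp,
        mem_Ioc_of_abs_sub_div_lt hQ' hγ1 hyR hyp'⟩, hVV' p hp p' hp', ?_⟩))
      ⟨by rwa [Metric.mem_ball, Real.dist_eq], by rwa [Metric.mem_ball, Real.dist_eq]⟩
    rw [abs_sub_div_lt_div_iff hQR, abs_lt] at hyp
    rw [abs_sub_div_lt_div_iff hQR', abs_lt] at hyp'
    rw [hΔ, abs_lt]
    constructor <;> nlinarith
  have hvol : ∀ x : ℤ × ℤ, volume.real (Metric.ball ((x.1 : ℝ) / Q) (β / Q) ∩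
      Metric.ball ((x.2 : ℝ) / Q') (γ / Q')) ≤ 2 * ρ := by
    intro x
    rw [hρ, mul_min_of_nonneg _ _ zero_le_two]
    refine le_min ?_ ?_
    · refine (measureReal_mono Set.inter_subset_left measure_ball_lt_top.ne).trans_eq ?_
      rw [Real.volume_real_ball (by positivity)]
    · refine (measureReal_mono Set.inter_subset_right measure_ball_lt_top.ne).trans_eq ?_
      rw [Real.volume_real_ball (by positivity)]
  have hρΔ : ρ * Δ ≤ 2 * (β * γ) := by
    have h1 : ρ * (β * Q') ≤ γ / Q' * (β * Q') := by gcongr; exact min_le_right _ _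
    have h2 : ρ * (γ * Q) ≤ β / Q * (γ * Q) := by gcongr; exact min_le_left _ _
    have h3 : γ / Q' * (β * Q') = β * γ := by field_simp
    have h4 : β / Q * (γ * Q) = β * γ := by field_simp
    rw [hΔ, mul_add]; linarith
  calc _ ≤ volume.real (⋃ x ∈ P, (Metric.ball ((x.1 : ℝ) / Q) (β / Q) ∩
        Metric.ball ((x.2 : ℝ) / Q') (γ / Q'))) := by
        refine measureReal_mono hsub (ne_of_lt ?_)
        refine (measure_biUnion_finset_le _ _).trans_lt (ENNReal.sum_lt_top.2 fun x _ => ?_)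
        exact (measure_mono Set.inter_subset_left).trans_lt measure_ball_lt_top
    _ ≤ ∑ x ∈ P, volume.real (Metric.ball ((x.1 : ℝ) / Q) (β / Q) ∩
        Metric.ball ((x.2 : ℝ) / Q') (γ / Q')) := measureReal_biUnion_finset_le _ _
    _ ≤ P.card • (2 * ρ) := Finset.sum_le_card_nsmul _ _ _ fun x _ => hvol x
    _ = P.card * (2 * ρ) := nsmul_eq_mul _ _
    _ ≤ 4 * (R + 1 : ℕ) * Δ * (2 * ρ) := by gcongr
    _ = 8 * (R + 1) * (ρ * Δ) := by push_cast; ring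
    _ ≤ 8 * (R + 1) * (2 * (β * γ)) := by gcongr
    _ = _ := by ring

open MeasureTheory in
/-- Distinct fractions of denominator `Q` have disjoint neighbourhoods of radius
`β / Q ≤ 1 / (2 Q)`. -/
theorem le_volume_approxSet_inter {Q : ℕ} (hQ : 0 < Q) {V : Set ℤ} {u v β : ℝ} (hβ : 0 ≤ β)
    (hβ2 : β ≤ 1 / 2) :
    (V ∩ Set.Ioc ⌈u * (Q : ℝ)⌉ (⌊v * (Q : ℝ)⌋ - 1)).ncard * (2 * (β / Q)) ≤
      volume.real (approxSet V Q β ∩ Set.Ico u v) := by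
  have hQR : (0 : ℝ) < Q := by exact_mod_cast hQ
  have hfin : (V ∩ Set.Ioc ⌈u * (Q : ℝ)⌉ (⌊v * (Q : ℝ)⌋ - 1)).Finite :=
    (Set.finite_Ioc _ _).inter_of_right _
  have hsub : ⋃ p ∈ hfin.toFinset, Metric.ball ((p : ℝ) / Q) (β / Q) ⊆
      approxSet V Q β ∩ Set.Ico u v := by
    intro x hx
    simp only [Set.mem_iUnion, Set.Finite.mem_toFinset, Metric.mem_ball, Real.dist_eq] at hx
    obtain ⟨p, ⟨hpV, hp1, hp2⟩, hx⟩ := hx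
    refine ⟨⟨p, hpV, hx⟩, ?_⟩
    have h1 : u * Q + 1 ≤ p := by
      have : ((⌈u * (Q : ℝ)⌉ + 1 : ℤ) : ℝ) ≤ p := by exact_mod_cast hp1
      push_cast at this
      linarith [Int.le_ceil (u * (Q : ℝ))]
    have h2 : (p : ℝ) + 1 ≤ v * Q := by
      have : (p : ℝ) ≤ ((⌊v * (Q : ℝ)⌋ - 1 : ℤ) : ℝ) := by exact_mod_cast hp2
      push_cast at this
      linarith [Int.floor_le (v * (Q : ℝ))]
    rw [abs_sub_div_lt_div_iff hQR, abs_lt] at hx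
    constructor
    · exact le_of_mul_le_mul_right (by linarith) hQR
    · exact lt_of_mul_lt_mul_right (by linarith) hQR.le
  have hdisj : (hfin.toFinset : Set ℤ).PairwiseDisjoint
      fun p : ℤ => Metric.ball ((p : ℝ) / Q) (β / Q) := by
    intro p _ p' _ hpp'
    refine Metric.ball_disjoint_ball ?_
    rw [Real.dist_eq, ← add_div, ← sub_div, abs_div, abs_of_pos hQR]
    gcongr
    have : (1 : ℝ) ≤ |(p : ℝ) - p'| := by
      exact_mod_cast Int.one_le_abs (sub_ne_zero.2 hpp')
    linarith
  calc _ = ∑ p ∈ hfin.toFinset, volume.real (Metric.ball ((p : ℝ) / Q) (β / Q)) := by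
        rw [Finset.sum_congr rfl fun p _ => Real.volume_real_ball (by positivity),
          Finset.sum_const, nsmul_eq_mul, Set.ncard_eq_toFinset_card _ hfin]
    _ = volume.real (⋃ p ∈ hfin.toFinset, Metric.ball ((p : ℝ) / Q) (β / Q)) :=
        (measureReal_biUnion_finset hdisj (fun _ _ => measurableSet_ball)
          (fun _ _ => measure_ball_lt_top.ne)).symm
    _ ≤ _ := measureReal_mono hsub (ne_of_lt
        ((measure_mono Set.inter_subset_right).trans_lt measure_Ico_lt_top))

/-! ### Quasi-independent events -/

open MeasureTheory in
/-- Bonferroni's inequality for events that are at worst quasi-independent. -/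
theorem sum_measureReal_sub_le {Ω ι : Type*} [MeasurableSpace Ω] {μ : Measure Ω}
    [IsFiniteMeasure μ] {E : ι → Set Ω} (hE : ∀ k, MeasurableSet (E k)) {b : ι → ℝ}
    (hb : ∀ k, 0 ≤ b k) {C : ℝ} (hC : 0 ≤ C) (F : Finset ι)
    (hEE : ∀ k ∈ F, ∀ l ∈ F, k ≠ l → μ.real (E k ∩ E l) ≤ C * b k * b l) :
    ∑ k ∈ F, μ.real (E k) - C * (∑ k ∈ F, b k) ^ 2 ≤ μ.real (⋃ k ∈ F, E k) := by
  classical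
  induction F using Finset.induction_on with
  | empty => simp
  | insert k F hk ih =>
    have ih := ih fun i hi j hj =>
      hEE i (Finset.mem_insert_of_mem hi) j (Finset.mem_insert_of_mem hj)
    have hU : MeasurableSet (⋃ l ∈ F, E l) := F.measurableSet_biUnion fun l _ => hE l
    have h1 := measureReal_union_add_inter (μ := μ) (s := E k) hU (measure_ne_top _ _)
      (measure_ne_top _ _)
    have h2 : μ.real (E k ∩ ⋃ l ∈ F, E l) ≤ C * b k * ∑ l ∈ F, b l := by
      rw [Set.inter_iUnion₂, Finset.mul_sum]
      refine (measureReal_biUnion_finset_le _ _).trans (Finset.sum_le_sum fun l hl => ?_)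
      exact hEE k (Finset.mem_insert_self _ _) l (Finset.mem_insert_of_mem hl)
        (fun h => hk (h ▸ hl))
    rw [Finset.sum_insert hk, Finset.sum_insert hk, Finset.set_biUnion_insert]
    have hS : 0 ≤ ∑ l ∈ F, b l := Finset.sum_nonneg fun l _ => hb l
    have h3 : C * b k * ∑ l ∈ F, b l ≤
        C * (b k + ∑ l ∈ F, b l) ^ 2 - C * (∑ l ∈ F, b l) ^ 2 := by
      have := mul_nonneg hC (mul_nonneg (hb k) hS)
      nlinarith [mul_nonneg hC (sq_nonneg (b k))]
    linarith

open MeasureTheory Filter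

/-! ### Approximation by finite unions of cells -/

/-- A compact set can be covered, inside any open neighbourhood, by finitely many of the pairwise
disjoint cells `[j / N, (j + 1) / N)`. -/
theorem IsCompact.exists_cells {K U : Set ℝ} (hK : IsCompact K) (hU : IsOpen U) (hKU : K ⊆ U) :
    ∃ N : ℕ, 0 < N ∧ ∃ J : Finset ℤ, K ⊆ ⋃ j ∈ J, Set.Ico ((j : ℝ) / N) ((j + 1) / N) ∧
      ⋃ j ∈ J, Set.Ico ((j : ℝ) / N) ((j + 1) / N) ⊆ U := by
  obtain ⟨δ, hδ, hthick⟩ := hK.exists_thickening_subset_open hU hKU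
  obtain ⟨n, hn⟩ := exists_nat_one_div_lt hδ
  have hN : (0 : ℝ) < ((n + 1 : ℕ) : ℝ) := by positivity
  obtain ⟨r, hr⟩ := hK.isBounded.subset_closedBall 0
  have hfin : ((fun x : ℝ => ⌊x * ((n + 1 : ℕ) : ℝ)⌋) '' K).Finite := by
    refine (Set.finite_Icc ⌊-r * ((n + 1 : ℕ) : ℝ)⌋ ⌊r * ((n + 1 : ℕ) : ℝ)⌋).subset ?_
    rintro _ ⟨x, hx, rfl⟩
    have := hr hx
    rw [mem_closedBall_zero_iff, Real.norm_eq_abs, abs_le] at this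
    exact ⟨Int.floor_le_floor (by nlinarith), Int.floor_le_floor (by nlinarith)⟩
  have hmem : ∀ x : ℝ, x ∈ Set.Ico ((⌊x * ((n + 1 : ℕ) : ℝ)⌋ : ℝ) / ((n + 1 : ℕ) : ℝ))
      ((⌊x * ((n + 1 : ℕ) : ℝ)⌋ + 1) / ((n + 1 : ℕ) : ℝ)) := fun x =>
    ⟨(div_le_iff₀ hN).2 (Int.floor_le _), (lt_div_iff₀ hN).2 (Int.lt_floor_add_one _)⟩
  refine ⟨n + 1, n.succ_pos, hfin.toFinset, fun x hx => ?_, ?_⟩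
  · exact Set.mem_biUnion (hfin.mem_toFinset.2 ⟨x, hx, rfl⟩) (hmem x)
  · refine Set.iUnion₂_subset fun j hj y hy => hthick ?_
    obtain ⟨x, hx, rfl⟩ := hfin.mem_toFinset.1 hj
    refine Metric.mem_thickening_iff.2 ⟨x, hx, lt_of_lt_of_le ?_ hn.le⟩
    have h1 := hmem x
    simp only [Set.mem_Ico, add_div] at h1 hy
    rw [Real.dist_eq, abs_lt]
    push_cast at h1 hy ⊢
    constructor <;> linarith

/-- A proportional lower bound for `E` in each of finitely many disjoint pieces passes to their
union. -/
theorem mul_measureReal_biUnion_le {ι : Type*} {J : Finset ι} {I : ι → Set ℝ}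
    (hI : ∀ j ∈ J, MeasurableSet (I j)) (hfin : ∀ j ∈ J, volume (I j) ≠ ⊤)
    (hdisj : (J : Set ι).PairwiseDisjoint I) {E : Set ℝ} (hE : MeasurableSet E) {t : ℝ}
    (h : ∀ j ∈ J, t * volume.real (I j) ≤ volume.real (E ∩ I j)) :
    t * volume.real (⋃ j ∈ J, I j) ≤ volume.real (E ∩ ⋃ j ∈ J, I j) := by
  rw [Set.inter_iUnion₂, measureReal_biUnion_finset hdisj hI hfin, Finset.mul_sum,
    measureReal_biUnion_finset
      (fun i hi j hj hij => (hdisj hi hj hij).mono Set.inter_subset_right Set.inter_subset_right)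
      (fun j hj => hE.inter (hI j hj))
      (fun j hj => ne_top_of_le_ne_top (hfin j hj) (measure_mono Set.inter_subset_right))]
  exact Finset.sum_le_sum h

/-! ### Choosing the weights -/

theorem not_summable_min {f : ℕ → ℝ} (hf : ¬ Summable f) {ε : ℝ} (hε : 0 < ε) :
    ¬ Summable fun k => min (f k) ε := by
  intro h
  refine hf ((summable_congr_atTop ?_).1 h)
  filter_upwards [h.tendsto_atTop_zero.eventually_lt_const hε] with k hk
  exact min_eq_left (not_lt.1 fun h' => hk.ne (min_eq_right h'.le))

/-- Since no single term exceeds `ε`, the sum from `K` on cannot jump over `[ε, 2 ε]`. -/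
theorem exists_sum_Ico_mem_Icc {b : ℕ → ℝ} (hb : ∀ k, 0 ≤ b k) (hsum : ¬ Summable b) {ε : ℝ}
    (hbε : ∀ k, b k ≤ ε) (K : ℕ) :
    ∃ n, ∑ k ∈ Finset.Ico K n, b k ∈ Set.Icc ε (2 * ε) := by
  classical
  have hε : 0 ≤ ε := (hb 0).trans (hbε 0)
  have hex : ∃ n, ε ≤ ∑ k ∈ Finset.Ico K n, b k := by
    by_contra! hcon
    refine hsum ((summable_nat_add_iff K).1 (summable_of_sum_range_le (fun k => hb _)
      (c := ε) fun n => ?_))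
    have := hcon (K + n)
    rw [Finset.sum_Ico_eq_sum_range, Nat.add_sub_cancel_left] at this
    simpa only [add_comm] using this.le
  refine ⟨Nat.find hex, Nat.find_spec hex, ?_⟩
  rcases Nat.eq_zero_or_pos (Nat.find hex) with h0 | h0
  · rw [h0]; simpa using hε
  · obtain ⟨m, hm⟩ := Nat.exists_eq_add_of_le' h0
    have hlt := not_le.1 (Nat.find_min hex (m := m) (by omega))
    rw [hm]
    rcases le_or_gt K m with h | h
    · rw [Finset.sum_Ico_succ_top h]
      linarith [hbε m]
    · rw [Finset.Ico_eq_empty (by omega)]; simpa using hε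

/-- If the weighted averages of `s ≤ 1` exceed `c` infinitely often, then `∑ α k` diverges already
over the indices with `s k ≥ c / 2`: the others contribute at most `c / 2` to each average. -/
theorem not_summable_indicator_of_average_lt {α s : ℕ → ℝ} (hα : ∀ k, 0 ≤ α k)
    (hs : ∀ k, s k ≤ 1)
    (h_div : Tendsto (fun n : ℕ => ∑ k ∈ Finset.range n, α k) atTop atTop) {c : ℝ} (hc : 0 < c)
    (h : {n : ℕ | c * ∑ k ∈ Finset.range n, α k < ∑ k ∈ Finset.range n, α k * s k}.Infinite) :
    ¬ Summable ({k | c / 2 ≤ s k}.indicator α) := by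
  intro hsum
  have hnn : ∀ k, 0 ≤ ({k | c / 2 ≤ s k}.indicator α) k :=
    Set.indicator_nonneg fun k _ => hα k
  obtain ⟨N, hN⟩ := eventually_atTop.1 (h_div.eventually_gt_atTop
    ((∑' k, ({k | c / 2 ≤ s k}.indicator α) k) / (c / 2)))
  obtain ⟨n, hn, hNn⟩ := h.exists_gt N
  have h1 := hN n hNn.le
  rw [div_lt_iff₀ (by positivity)] at h1
  have h2 := hsum.sum_le_tsum (Finset.range n) fun k _ => hnn k
  have h3 : ∑ k ∈ Finset.range n, α k * s k ≤
      ∑ k ∈ Finset.range n, (({k | c / 2 ≤ s k}.indicator α) k + c / 2 * α k) := by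
    refine Finset.sum_le_sum fun k _ => ?_
    by_cases hk : c / 2 ≤ s k
    · rw [Set.indicator_of_mem (by exact hk)]
      nlinarith [hα k, hs k]
    · rw [Set.indicator_of_notMem (by exact hk)]
      nlinarith [hα k, hs k]
  rw [Finset.sum_add_distrib, ← Finset.mul_sum] at h3
  have hn' : c * ∑ k ∈ Finset.range n, α k < ∑ k ∈ Finset.range n, α k * s k := hn
  linarith

/-! ### Almost every real is approximated infinitely often -/

/-- A union of quasi-independent events over any tail of the index set fills a definite part
of `A`. -/
theorem exists_finset_le_measureReal_biUnion_inter {E : ℕ → Set ℝ}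
    (hE : ∀ k, MeasurableSet (E k)) {A : Set ℝ} (hA : volume A ≠ ⊤) {b : ℕ → ℝ}
    (hb : ∀ k, 0 ≤ b k) (hsum : ¬ Summable b) {ε C t : ℝ} (hbε : ∀ k, b k ≤ ε) (hC : 0 ≤ C)
    (ht : 0 ≤ t) (K : ℕ) (hlow : ∀ k, K ≤ k → b k * t ≤ volume.real (E k ∩ A))
    (hover : ∀ k l, k ≠ l → volume.real (E k ∩ E l ∩ A) ≤ C * b k * b l) :
    ∃ F : Finset ℕ, (∀ k ∈ F, K ≤ k) ∧
      ε * (t - 4 * C * ε) ≤ volume.real ((⋃ k ∈ F, E k) ∩ A) := by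
  obtain ⟨n, hn1, hn2⟩ := exists_sum_Ico_mem_Icc hb hsum hbε K
  have : IsFiniteMeasure (volume.restrict A) := isFiniteMeasure_restrict.2 hA
  refine ⟨Finset.Ico K n, fun k hk => (Finset.mem_Ico.1 hk).1, ?_⟩
  have h := sum_measureReal_sub_le (μ := volume.restrict A) hE hb hC (Finset.Ico K n)
    fun k _ l _ hkl => by
      rw [measureReal_restrict_apply ((hE k).inter (hE l))]
      exact hover k l hkl
  rw [measureReal_restrict_apply (Finset.measurableSet_biUnion _ fun k _ => hE k)] at h
  have hl : (∑ k ∈ Finset.Ico K n, b k) * t ≤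
      ∑ k ∈ Finset.Ico K n, (volume.restrict A).real (E k) := by
    rw [Finset.sum_mul]
    refine Finset.sum_le_sum fun k hk => ?_
    rw [measureReal_restrict_apply (hE k)]
    exact hlow k (Finset.mem_Ico.1 hk).1
  set S := ∑ k ∈ Finset.Ico K n, b k
  have hε : 0 ≤ ε := (hb 0).trans (hbε 0)
  have h1 : C * S ^ 2 ≤ C * (2 * ε) ^ 2 := by
    gcongr
    exact hε.trans hn1
  have h2 : ε * t ≤ S * t := by gcongr
  nlinarith

/-- Both fractions are in lowest terms, so equality would force `q ^ d = q' ^ d`. -/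
theorem admissible_fractions_ne {a : ℤ} {d q q' : ℕ} (hd : 1 ≤ d) (hqq' : q ≠ q') {p p' : ℤ}
    (hp : p ∈ admissibleNumerators a d q) (hp' : p' ∈ admissibleNumerators a d q') :
    p * (q' ^ d : ℕ) ≠ p' * (q ^ d : ℕ) := by
  intro h
  push_cast at h
  have h1 : (q : ℤ) ^ d ∣ (q' : ℤ) ^ d :=
    (hp.1.symm.pow_left (m := d)).dvd_of_dvd_mul_left (h ▸ dvd_mul_left _ _)
  have h2 : (q' : ℤ) ^ d ∣ (q : ℤ) ^ d :=
    (hp'.1.symm.pow_left (m := d)).dvd_of_dvd_mul_left (h ▸ dvd_mul_left _ _)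
  have h3 : q ^ d = q' ^ d := Nat.dvd_antisymm (by exact_mod_cast h1) (by exact_mod_cast h2)
  exact hqq' (Nat.pow_left_injective (by omega) h3)

theorem corollary1 (d : ℕ) (hd : 1 ≤ d) (q : ℕ → ℕ) (hq_pos : ∀ k, 0 < q k)
    (hq : StrictMono q) (α : ℕ → ℝ) (hα_pos : ∀ k, 0 < α k) (a : ℤ) (ha : 1 ≤ a)
    (h_div : Filter.Tendsto (fun n : ℕ => ∑ k ∈ Finset.range n, α k) Filter.atTop Filter.atTop)
    (c : ℝ) (hc : 0 < c)
    (h_dens : {n : ℕ | c * ∑ k ∈ Finset.range n, α k <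
      ∑ k ∈ Finset.range n, α k * powerResidueDensity d (q k ^ d)}.Infinite)
    (h_gcd : ∀ k, IsCoprime (q k : ℤ) a) :
    ∀ᵐ x : ℝ ∂MeasureTheory.volume,
      {k : ℕ | ∃ p : ℤ, IsCoprime p (q k : ℤ) ∧
        |x - (p : ℝ) / (q k : ℝ) ^ d| < α k / (q k : ℝ) ^ d ∧
        ∃ b : ℤ, IsCoprime b (q k : ℤ) ∧ p ≡ a * b ^ d [ZMOD (q k : ℤ)]}.Infinite := by
  have hQ : ∀ k, 0 < q k ^ d := fun k => pow_pos (hq_pos k) d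
  have hQR : ∀ k, (0 : ℝ) < ((q k ^ d : ℕ) : ℝ) := fun k => by exact_mod_cast hQ k
  set V : ℕ → Set ℤ := fun k => admissibleNumerators a d (q k) with hV
  -- If the claim fails, then some tail of the sets is missed by a set `B K₀` of positive measure.
  set B : ℕ → Set ℝ := fun K => ⋂ k ∈ Set.Ici K, (approxSet (V k) (q k ^ d : ℕ) (α k))ᶜ with hB
  suffices hnull : ∀ K, volume (B K) = 0 by
    rw [ae_iff]
    refine measure_mono_null (fun x hx => ?_) (measure_iUnion_null hnull)
    obtain ⟨K, hK⟩ := (Set.not_infinite.1 hx).bddAbove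
    refine Set.mem_iUnion.2 ⟨K + 1, Set.mem_iInter₂.2 fun k hk hxk => ?_⟩
    obtain ⟨p, ⟨hp1, hp2⟩, hp3⟩ := hxk
    have : k ≤ K := hK ⟨p, hp1, by exact_mod_cast hp3, hp2⟩
    have : K + 1 ≤ k := hk
    omega
  intro K₀
  by_contra hpos
  have hBmeas : MeasurableSet (B K₀) := (isClosed_biInter fun k _ =>
    (isOpen_approxSet _ _ _).isClosed_compl).measurableSet
  obtain ⟨Z, hZB, hZ, hZpos⟩ := hBmeas.exists_lt_isCompact (pos_iff_ne_zero.2 hpos)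
  have hZfin : volume Z ≠ ⊤ := hZ.measure_lt_top.ne
  set κ := volume.real Z with hκ
  have hκ0 : 0 < κ := ENNReal.toReal_pos hZpos.ne' hZfin
  obtain ⟨r, hr⟩ := hZ.isBounded.subset_ball 0
  obtain ⟨R, hrR⟩ := exists_nat_ge r
  have hZR : Z ⊆ Metric.ball 0 R := hr.trans (Metric.ball_subset_ball hrR)
  set s := c / 2 with hs
  have hs0 : 0 < s := by positivity
  set C : ℝ := 16 * (R + 1) with hC
  have hC0 : 0 < C := by positivity
  -- Of the lower bound `ε * (s * κ - 4 * C * ε)` at least `ε * s * κ / 2` has to survive, with `ε`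
  -- depending on `Z` only: the set `A` below is chosen in terms of `ε`.
  set ε : ℝ := min (1 / 2) (s * κ / (8 * C)) with hε
  have hε0 : 0 < ε := by positivity
  have hε2 : ε ≤ 1 / 2 := min_le_left _ _
  have hεC : 4 * C * ε ≤ s * κ / 2 := by
    have h : ε ≤ s * κ / (8 * C) := min_le_right _ _
    rw [le_div_iff₀ (by positivity)] at h
    linarith
  set G : Set ℕ := {k | s ≤ powerResidueDensity d (q k ^ d)} with hG
  set b : ℕ → ℝ := fun k => min (G.indicator α k) ε with hb
  have hind : ∀ k, 0 ≤ G.indicator α k := Set.indicator_nonneg fun k _ => (hα_pos k).le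
  have hb0 : ∀ k, 0 ≤ b k := fun k => le_min (hind k) hε0.le
  have hbε : ∀ k, b k ≤ ε := fun k => min_le_right _ _
  have hbα : ∀ k, b k ≤ α k := fun k => (min_le_left _ _).trans
    (Set.indicator_le_self' (fun k _ => (hα_pos k).le) k)
  have hbG : ∀ k, k ∉ G → b k = 0 := fun k hk => by
    rw [hb]; simp only [Set.indicator_of_notMem hk]; exact min_eq_left hε0.le
  have hbsum : ¬ Summable b := not_summable_min (not_summable_indicator_of_average_lt
    (fun k => (hα_pos k).le) (fun k => powerResidueDensity_le_one d (hQ k)) h_div hc h_dens) hε0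
  set E : ℕ → Set ℝ := fun k => approxSet (V k) (q k ^ d : ℕ) (b k) with hE
  have hEmeas : ∀ k, MeasurableSet (E k) := fun k => (isOpen_approxSet _ _ _).measurableSet
  -- Enclose the compact set in a finite union `A` of cells with little excess measure.
  obtain ⟨U, hZU, hU, -, hUZ⟩ := hZ.measurableSet.exists_isOpen_sdiff_lt hZfin
    (ε := ENNReal.ofReal (ε * (s * κ / 2))) (by positivity)
  obtain ⟨N, hN, J, hZA, hAU⟩ := hZ.exists_cells (hU.inter Metric.isOpen_ball)
    (Set.subset_inter hZU hZR)
  have hNR : (0 : ℝ) < N := by exact_mod_cast hN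
  set I : ℤ → Set ℝ := fun j => Set.Ico ((j : ℝ) / N) ((j + 1) / N) with hI
  set A : Set ℝ := ⋃ j ∈ J, I j with hA
  have hAR : A ⊆ Metric.ball 0 R := hAU.trans Set.inter_subset_right
  have hAfin : volume A ≠ ⊤ := ne_top_of_le_ne_top measure_ball_lt_top.ne (measure_mono hAR)
  have hκA : κ ≤ volume.real A := measureReal_mono hZA hAfin
  have hdisj : (J : Set ℤ).PairwiseDisjoint I := by
    intro i _ j _ hij
    refine Set.disjoint_left.2 fun x hxi hxj => hij ?_
    have key : ∀ i : ℤ, x ∈ I i → ⌊x * N⌋ = i := fun i hi =>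
      Int.floor_eq_iff.2 ⟨(div_le_iff₀ hNR).1 hi.1, (lt_div_iff₀ hNR).1 hi.2⟩
    rw [← key i hxi, key j hxj]
  have hev : ∀ᶠ k in atTop, ∀ j ∈ J, k ∈ G → b k * s * volume.real (I j) ≤
      volume.real (E k ∩ I j) := by
    rw [Filter.eventually_all_finset]
    intro j _
    have huv : (j : ℝ) / N < (j + 1) / N := by gcongr; linarith
    filter_upwards [hq.tendsto_atTop.eventually
      (eventually_le_ncard_admissibleNumerators (a := a) hd hs0 huv)] with k hk hkG
    have h1 := hk (h_gcd k) (hkG.trans (powerResidueDensity_pow_le hd (hq_pos k)))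
    have h2 := le_volume_approxSet_inter (hQ k) (V := V k) (u := j / N) (v := (j + 1) / N)
      (hb0 k) ((hbε k).trans hε2)
    refine le_trans ?_ h2
    rw [hI, Real.volume_real_Ico_of_le huv.le]
    have h3 : 0 ≤ 2 * (b k / ((q k ^ d : ℕ) : ℝ)) :=
      mul_nonneg zero_le_two (div_nonneg (hb0 k) (hQR k).le)
    refine le_trans (le_of_eq ?_) (mul_le_mul_of_nonneg_right
      (b := s / 2 * (((j : ℝ) + 1) / N - j / N) * ((q k ^ d : ℕ) : ℝ)) ?_ h3)
    · have := (hQR k).ne'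
      field_simp
    · simpa only [Nat.cast_pow] using h1
  obtain ⟨K₁, hK₁⟩ := eventually_atTop.1 hev
  have hlow : ∀ k, max K₀ K₁ ≤ k → b k * (s * κ) ≤ volume.real (E k ∩ A) := by
    intro k hk
    by_cases hkG : k ∈ G
    · have h := mul_measureReal_biUnion_le (fun j _ => measurableSet_Ico)
        (fun j _ => measure_Ico_lt_top.ne) hdisj (hEmeas k)
        (fun j hj => hK₁ k ((le_max_right _ _).trans hk) j hj hkG)
      refine le_trans ?_ h
      rw [← mul_assoc]
      exact mul_le_mul_of_nonneg_left hκA (mul_nonneg (hb0 k) hs0.le)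
    · rw [hbG k hkG, zero_mul]; exact measureReal_nonneg
  have hover : ∀ k l, k ≠ l → volume.real (E k ∩ E l ∩ A) ≤ C * b k * b l := by
    intro k l hkl
    refine (measureReal_mono (Set.inter_subset_inter_right _ hAR) (ne_top_of_le_ne_top
      measure_ball_lt_top.ne (measure_mono Set.inter_subset_right))).trans ?_
    exact volume_approxSet_inter_le (hQ k) (hQ l)
      (fun p hp p' hp' => admissible_fractions_ne hd (hq.injective.ne hkl) hp hp')
      (hb0 k) (hb0 l) ((hbε k).trans (by linarith)) ((hbε l).trans (by linarith)) R
  obtain ⟨F, hFK, hF⟩ := exists_finset_le_measureReal_biUnion_inter hEmeas hAfin hb0 hbsum hbε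
    hC0.le (by positivity) (max K₀ K₁) hlow hover
  -- The sets with index at least `K₀` avoid `Z`, so their union meets `A` only in `A \ Z`.
  have hsub : (⋃ k ∈ F, E k) ∩ A ⊆ U \ Z := by
    rintro x ⟨hxE, hxA⟩
    obtain ⟨k, hk, hxk⟩ := Set.mem_iUnion₂.1 hxE
    refine ⟨(hAU hxA).1, fun hxZ => ?_⟩
    exact Set.mem_iInter₂.1 (hZB hxZ) k ((le_max_left _ _).trans (hFK k hk))
      (approxSet_mono (hQR k).le (hbα k) hxk)
  have hlt : volume.real ((⋃ k ∈ F, E k) ∩ A) < ε * (s * κ / 2) :=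
    (measureReal_mono hsub hUZ.ne_top).trans_lt (ENNReal.toReal_lt_of_lt_ofReal hUZ)
  have hge : ε * (s * κ / 2) ≤ ε * (s * κ - 4 * C * ε) := by gcongr; linarith
  linarith
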